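/- Let $\sigma>0$, $B\in\mathbb R$. A two-armed bandit model is a pair $\nu=(\nu_1,\nu_2)$ of probability distributions on $\mathbb R$ with means $\mu_1,\mu_2\in[0,B]$ that are $\sigma$-sub-Gaussian, i.e. $\mathbb E_{X\sim\nu_i}[e^{t(X-\mu_i)}]\le e^{\sigma^2t^2/2}$ for all $t\in\mathbb R$. For $\Delta\ge 0$ let $\mathcal M_\Delta$ be the set of the models with $\mu_1-\mu_2=\Delta$. A policy decides in each round, from the past pulls and rewards and from its own randomness, to pull an arm (and to observe an independent sample of its distribution) or to stop and recommend an arm $\hat I$; if $\tau$ is the total number of pulls and $c>0$ is the cost of a pull, its risk is $R_1(\pi,\nu)=\mathbb P_{\nu,\pi}(\mu_1\ne\mu_{\hat I})+c\,\mathbb E_{\nu,\pi}[\tau]$. Put $$h_1(\Delta)=\begin{cases}\dfrac{\sigma^2c}{4\Delta^2}\log\dfrac{e\Delta^2}{\sigma^2c}, & \Delta\ge\sqrt{\sigma^2c},\\[1ex] \dfrac14, & \Delta<\sqrt{\sigma^2c}.\end{cases}$$ The racing policy with parameters $N^*,\delta>0$ works in epochs, in each of which it pulls each arm once. As long as the number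 $n$ of completed epochs satisfies $n\le N^*$ and the empirical means satisfy $|\hat\mu_1(n)-\hat\mu_2(n)|\le\sqrt{4\sigma^2n^{-1}\log(2n/\delta)}$ (or $n=0$), it runs another epoch; otherwise it stops and recommends the arm with the larger empirical mean, where a tie is broken by a fair coin. Let $0<c<\frac14$, and let $\pi$ be the racing policy with $N^*=(2ec)^{-1}$ and $\delta=c(1+2cN^*)^{-1}$. Then for every $\Delta\ge0$ $$\sup_{\nu\in\mathcal M_\Delta}R_1(\pi,\nu)\le 128\log\left(\frac{e+1}{(ec)^2}\right)h_1(\Delta)+3c,$$ and the right-hand side is $O\left(\log(1/c)\,h_1(\Delta)\right)$: there is a constant $C$, depending only on $\sigma$ and $B$, such that for all $0<c<\frac14$ and all $\Delta\in[0,B]$ it is at most $C\log(1/c)\,h_1(\Delta)$. -/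

import Mathlib

open MeasureTheory ProbabilityTheory

/-- What a policy for two arms does in a round: it pulls an arm, or it stops and recommends
an arm. The two arms are `0` and `1`. -/
inductive Decision where
  | pull (a : Fin 2)
  | recommend (a : Fin 2)

namespace Decision

instance : MeasurableSpace Decision := ⊤

/-- The arm that is pulled or recommended. -/
def arm : Decision → Fin 2
  | pull a => a
  | recommend a => a

end Decision

/-- A (randomised) policy for two arms: given its internal randomness (a point of `[0, 1]`, which
will be uniformly distributed) and the arms pulled and rewards observed in the first `t` rounds,
it decides measurably what to do next. -/
structure Policy where
  next : (t : ℕ) → unitInterval × (Fin t → Fin 2 × ℝ) → Decision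
  measurable_next : ∀ t, Measurable (next t)

namespace Policy

/-- The arms and rewards of the first `t` rounds, for the internal randomness `u` and the
table `y`, in which `y (t, a)` is the reward that is observed if arm `a` is pulled in round `t`.
Only the rounds before the policy first stops have a meaning, and only they are ever used. -/
def history (p : Policy) (u : unitInterval) (y : ℕ × Fin 2 → ℝ) : (t : ℕ) → Fin t → Fin 2 × ℝ
  | 0 => Fin.elim0
  | t + 1 =>
      Fin.snoc (α := fun _ => Fin 2 × ℝ) (history p u y t)
        ((p.next t (u, history p u y t)).arm, y (t, (p.next t (u, history p u y t)).arm))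

/-- The decision of the policy after `t` rounds. -/
def decision (p : Policy) (u : unitInterval) (y : ℕ × Fin 2 → ℝ) (t : ℕ) : Decision :=
  p.next t (u, p.history u y t)

/-- The stopping time, that is, the total number of pulls (`⊤` if the policy never stops). -/
noncomputable def stopTime (p : Policy) (u : unitInterval) (y : ℕ × Fin 2 → ℝ) : ℕ∞ :=
  ⨅ (t : ℕ) (_ : ∃ a, p.decision u y t = Decision.recommend a), (t : ℕ∞)

/-- The policy stops and recommends arm `a`. -/
def Recommends (p : Policy) (u : unitInterval) (y : ℕ × Fin 2 → ℝ) (a : Fin 2) : Prop :=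
  ∃ t : ℕ, p.stopTime u y = t ∧ p.decision u y t = Decision.recommend a

end Policy

/-- The mean of a distribution on the real line. -/
noncomputable def armMean (l : ProbabilityMeasure ℝ) : ℝ := ∫ x, x ∂(l : Measure ℝ)

/-- `σ`-sub-Gaussian distributions: `E exp (t (X - E X)) ≤ exp (σ ^ 2 t ^ 2 / 2)` for all `t`. -/
def IsSubGaussian (σ : ℝ) (l : ProbabilityMeasure ℝ) : Prop :=
  HasSubgaussianMGF (fun x => x - armMean l) (σ ^ 2).toNNReal (l : Measure ℝ)

/-- Two-armed bandit models with `σ`-sub-Gaussian rewards and means in `[0, B]`. -/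
def banditModels (σ B : ℝ) : Set (Fin 2 → ProbabilityMeasure ℝ) :=
  {ν | ∀ a, IsSubGaussian σ (ν a) ∧ armMean (ν a) ∈ Set.Icc 0 B}

/-- The models whose first arm is better than the second one by exactly `Δ`. -/
def gapModels (σ B Δ : ℝ) : Set (Fin 2 → ProbabilityMeasure ℝ) :=
  {ν | ν ∈ banditModels σ B ∧ armMean (ν 0) - armMean (ν 1) = Δ}

/-- The law of the internal randomness of the policy and of the table of rewards: all are
independent, the first is uniform on `[0, 1]`, and the rewards of arm `a` have law `ν a`. -/
noncomputable def interactionLaw (ν : Fin 2 → ProbabilityMeasure ℝ) :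
    Measure (unitInterval × (ℕ × Fin 2 → ℝ)) :=
  (volume : Measure unitInterval).prod
    (Measure.infinitePi fun i : ℕ × Fin 2 => (ν i.2 : Measure ℝ))

open Classical in
/-- The risk `E [1 {the mean of the recommended arm is not that of the first arm} + c τ]`, where
`c` is the cost of a pull and `τ` is the total number of pulls. -/
noncomputable def riskOne (c : ℝ) (p : Policy) (ν : Fin 2 → ProbabilityMeasure ℝ) : ENNReal :=
  ∫⁻ z, ((if ∃ a, p.Recommends z.1 z.2 a ∧ armMean (ν 0) ≠ armMean (ν a) then 1 else 0)
    + ENNReal.ofReal c * (p.stopTime z.1 z.2 : ENNReal)) ∂(interactionLaw ν)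

/-- The worst-case risk over the models with gap `Δ` (it is `0` if there are no such models). -/
noncomputable def worstRiskOne (σ B c Δ : ℝ) (p : Policy) : ENNReal :=
  ⨆ ν ∈ gapModels σ B Δ, riskOne c p ν

/-- The hardness `h₁(Δ)`. -/
noncomputable def hardOne (σ c Δ : ℝ) : ℝ :=
  if √(σ ^ 2 * c) ≤ Δ then
    σ ^ 2 * c / (4 * Δ ^ 2) * Real.log (Real.exp 1 * Δ ^ 2 / (σ ^ 2 * c))
  else 1 / 4

namespace Racing

/-- The average of the rewards of arm `a`, after `n` epochs in which each arm is pulled once. -/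
noncomputable def empMean {t : ℕ} (n : ℕ) (h : Fin t → Fin 2 × ℝ) (a : Fin 2) : ℝ :=
  (n : ℝ)⁻¹ * ∑ s, if (h s).1 = a then (h s).2 else 0

/-- The confidence width `e_n`, for two arms. It is `0` for `n = 0`. -/
noncomputable def width (σ δ : ℝ) (n : ℕ) : ℝ :=
  √(4 * σ ^ 2 * (n : ℝ)⁻¹ * Real.log (2 * n * δ⁻¹))

open Classical in
/-- The arm with the largest empirical mean, where a tie is broken by a fair coin. -/
noncomputable def best {t : ℕ} (n : ℕ) (x : unitInterval × (Fin t → Fin 2 × ℝ)) : Fin 2 :=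
  if empMean n x.2 1 < empMean n x.2 0 then 0
  else if empMean n x.2 0 < empMean n x.2 1 then 1
  else if (x.1 : ℝ) < 1 / 2 then 0 else 1

open Classical in
/-- Pull the arms in turn, so that each epoch of two rounds has one pull of each arm. After `n`
epochs go on with another one if `n ≤ N` and the arms have not separated, otherwise stop. -/
noncomputable def next (σ N δ : ℝ) (t : ℕ) (x : unitInterval × (Fin t → Fin 2 × ℝ)) : Decision :=
  if t % 2 = 1 then Decision.pull 1
  else if (t / 2 : ℕ) ≤ N ∧
      |empMean (t / 2) x.2 0 - empMean (t / 2) x.2 1| ≤ width σ δ (t / 2) then Decision.pull 0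
  else Decision.recommend (best (t / 2) x)

theorem measurable_empMean {t : ℕ} (n : ℕ) (a : Fin 2) :
    Measurable fun x : unitInterval × (Fin t → Fin 2 × ℝ) => empMean n x.2 a := by
  unfold empMean
  refine Measurable.const_mul (Finset.measurable_sum _ fun s _ => ?_) _
  have h : Measurable fun x : unitInterval × (Fin t → Fin 2 × ℝ) => x.2 s := by fun_prop
  exact Measurable.ite (h.fst (measurableSet_singleton a)) h.snd measurable_const

theorem measurable_best {t : ℕ} (n : ℕ) : Measurable (best (t := t) n) := by
  unfold best
  refine Measurable.ite (measurableSet_lt (measurable_empMean n 1) (measurable_empMean n 0))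
    measurable_const (Measurable.ite
      (measurableSet_lt (measurable_empMean n 0) (measurable_empMean n 1)) measurable_const
      (Measurable.ite (measurableSet_lt (by fun_prop) measurable_const)
        measurable_const measurable_const))

theorem measurable_next (σ N δ : ℝ) (t : ℕ) : Measurable (next σ N δ t) := by
  unfold next
  refine Measurable.ite (MeasurableSet.const _) measurable_const (Measurable.ite ?_
    measurable_const ?_)
  · exact (MeasurableSet.const _).inter (measurableSet_le
      (((measurable_empMean _ 0).sub (measurable_empMean _ 1)).abs) measurable_const)
  · exact (measurable_from_top (f := Decision.recommend)).comp (measurable_best _)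

/-- The racing policy with (real) budget `N` of epochs and confidence parameter `δ`. -/
noncomputable def policy (σ N δ : ℝ) : Policy where
  next := next σ N δ
  measurable_next := measurable_next σ N δ

end Racing

/-! Until the policy stops, its pulls alternate deterministically, so the run is governed by `gap y
n`, the difference of empirical means read off the reward table. If ties are counted as errors, the
bounding events depend only on the table. By a union bound, an error forces either `gap` ≤ 0 at
epoch ⌊N⌋ + 1 or `gap` ≤ -`width` at some n ≤ ⌊N⌋; the expected number of epochs is at most 1 plus
the sum of the probabilities of `gap` ≤ `width`. All these events lie at deterministic times, so the
sub-Gaussian tail `rewardLaw_gap_le` applies to each. Summing the tails gives `riskOne_le`, of order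
σ²/(NΔ²) + δσ²/Δ² + c + cσ²L/Δ² with L = log(2N/δ). For the given N and δ every term but c is a
multiple of σ²c/Δ², up to the factor L. If Δ² ≥ eσ²c this is below the claim, as then h₁ ≥
σ²c/(2Δ²). For smaller Δ, h₁ is bounded below and the deterministic budget suffices
(`riskOne_le_trivial`). -/

namespace Racing

/-! ### The run of the policy on a fixed reward table -/

/-- The arm that is pulled in round `t`. -/
def turn (t : ℕ) : Fin 2 := if t % 2 = 1 then 1 else 0

/-- The difference of the empirical means of the two arms after `n` epochs. -/
noncomputable def gap (y : ℕ × Fin 2 → ℝ) (n : ℕ) : ℝ :=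
  (n : ℝ)⁻¹ * ∑ s ∈ Finset.range (2 * n), if s % 2 = 1 then -y (s, 1) else y (s, 0)

theorem history_eq {σ N δ : ℝ} {u : unitInterval} {y : ℕ × Fin 2 → ℝ} {t : ℕ}
    (h : ∀ k < t, ∀ a, (policy σ N δ).decision u y k ≠ Decision.recommend a) (s : Fin t) :
    (policy σ N δ).history u y t s = (turn s, y (s, turn s)) := by
  induction t with
  | zero => exact s.elim0
  | succ t ih =>
    have hd : ((policy σ N δ).decision u y t).arm = turn t := by
      have h' := h t (Nat.lt_succ_self t)
      simp only [Policy.decision, policy, next] at h' ⊢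
      unfold turn
      split_ifs at h' ⊢ with h1 h2
      · rfl
      · rfl
      · exact absurd rfl (h' _)
    simp only [Policy.decision] at hd
    simp only [Policy.history]
    refine Fin.lastCases ?_ (fun s => ?_) s
    · rw [Fin.snoc_last, hd]
      simp
    · rw [Fin.snoc_castSucc, ih (fun k hk => h k (by omega))]
      simp

theorem empMean_sub_empMean {σ N δ : ℝ} {u : unitInterval} {y : ℕ × Fin 2 → ℝ} {n : ℕ}
    (h : ∀ k < 2 * n, ∀ a, (policy σ N δ).decision u y k ≠ Decision.recommend a) :
    empMean n ((policy σ N δ).history u y (2 * n)) 0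
      - empMean n ((policy σ N δ).history u y (2 * n)) 1 = gap y n := by
  unfold empMean gap
  rw [← mul_sub, ← Finset.sum_sub_distrib, Finset.sum_range]
  congr 1
  refine Finset.sum_congr rfl fun s _ => ?_
  rw [history_eq h]
  unfold turn
  split_ifs <;> simp_all

theorem best_eq_one {t n : ℕ} {x : unitInterval × (Fin t → Fin 2 × ℝ)} (h : best n x = 1) :
    empMean n x.2 0 ≤ empMean n x.2 1 := by
  by_contra! hlt
  simp [best, hlt] at h

theorem width_nonneg (σ δ : ℝ) (n : ℕ) : 0 ≤ width σ δ n := Real.sqrt_nonneg _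

/-- The racing policy stops after a number `T ≤ ⌊N⌋ + 1` of epochs, before which the arms have not
separated, and errs only if the arms have separated in the wrong order or the budget is used up. -/
theorem exists_epochs {N : ℝ} (hN : 0 ≤ N) (σ δ : ℝ) (u : unitInterval) (y : ℕ × Fin 2 → ℝ) :
    ∃ T : ℕ, T ≤ ⌊N⌋₊ + 1 ∧ (∀ n < T, |gap y n| ≤ width σ δ n) ∧
      (policy σ N δ).stopTime u y = (2 * T : ℕ) ∧
      ((policy σ N δ).Recommends u y 1 →
        gap y (⌊N⌋₊ + 1) ≤ 0 ∨ ∃ n, 1 ≤ n ∧ n ≤ ⌊N⌋₊ ∧ gap y n ≤ -width σ δ n) := by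
  classical
  have hm : ∃ n : ℕ, ¬((n : ℝ) ≤ N ∧ |gap y n| ≤ width σ δ n) :=
    ⟨⌊N⌋₊ + 1, fun h => absurd h.1 (not_le.2 (by exact_mod_cast Nat.lt_floor_add_one N))⟩
  set T := Nat.find hm with hT
  have hbefore : ∀ n < T, (n : ℝ) ≤ N ∧ |gap y n| ≤ width σ δ n :=
    fun n hn => not_not.1 (Nat.find_min hm hn)
  have hat : ¬((T : ℝ) ≤ N ∧ |gap y T| ≤ width σ δ T) := Nat.find_spec hm
  have hTm : T ≤ ⌊N⌋₊ + 1 :=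
    Nat.find_min' hm fun h => absurd h.1 (not_le.2 (by exact_mod_cast Nat.lt_floor_add_one N))
  -- Strong induction: the empirical means in the history agree with `gap` only if no earlier
  -- decision was to stop.
  have hcont : ∀ k < 2 * T, ∀ a, (policy σ N δ).decision u y k ≠ Decision.recommend a := by
    intro k
    induction k using Nat.strong_induction_on with
    | _ k ih =>
      intro hk a
      rcases Nat.even_or_odd' k with ⟨n, rfl | rfl⟩
      · have he := empMean_sub_empMean (n := n) fun k hk' => ih k hk' (by omega)
        have hc := hbefore n (by omega)
        rw [← he] at hc
        have h2 : 2 * n / 2 = n := by omega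
        have h3 : ¬ 2 * n % 2 = 1 := by omega
        have h4 : (policy σ N δ).decision u y (2 * n) = Decision.pull 0 := by
          change next σ N δ (2 * n) _ = _
          rw [next, if_neg h3, h2, if_pos hc]
        simp [h4]
      · have h3 : (2 * n + 1) % 2 = 1 := by omega
        have h4 : (policy σ N δ).decision u y (2 * n + 1) = Decision.pull 1 := by
          change next σ N δ (2 * n + 1) _ = _
          rw [next, if_pos h3]
        simp [h4]
  have he := empMean_sub_empMean hcont
  have hdec : (policy σ N δ).decision u y (2 * T) =
      Decision.recommend (best T (u, (policy σ N δ).history u y (2 * T))) := by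
    have h2 : 2 * T / 2 = T := by omega
    have h3 : ¬ 2 * T % 2 = 1 := by omega
    rw [← he] at hat
    change next σ N δ (2 * T) _ = _
    rw [next, if_neg h3, h2, if_neg hat]
  have hτ : (policy σ N δ).stopTime u y = (2 * T : ℕ) := by
    refine le_antisymm (iInf₂_le (2 * T) ⟨_, hdec⟩) (le_iInf₂ fun t ht => ?_)
    obtain ⟨a, ha⟩ := ht
    exact Nat.cast_le.2 (not_lt.1 fun hlt => hcont t hlt a ha)
  refine ⟨T, hTm, fun n hn => (hbefore n hn).2, hτ, ?_⟩
  rintro ⟨t, ht, hrec⟩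
  obtain rfl : 2 * T = t := by
    rw [hτ] at ht
    exact_mod_cast ht
  rw [hdec, Decision.recommend.injEq] at hrec
  have hle := best_eq_one hrec
  have hgap : gap y T ≤ 0 := by
    rw [← he]
    exact sub_nonpos.2 hle
  rcases Nat.lt_or_ge ⌊N⌋₊ T with h | h
  · left
    rwa [show ⌊N⌋₊ + 1 = T by omega]
  · right
    have hTN : (T : ℝ) ≤ N := (Nat.le_floor_iff hN).1 h
    have hw : width σ δ T < |gap y T| := not_le.1 fun h' => hat ⟨hTN, h'⟩
    -- T = 0 is impossible: since 0⁻¹ = 0, both `gap` and `width` vanish at n = 0, so the strict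
    -- inequality `hw` fails.
    refine ⟨T, Nat.one_le_iff_ne_zero.2 fun h0 => ?_, h, ?_⟩
    · rw [h0] at hw
      simp [gap, width] at hw
    · rw [abs_of_nonpos hgap] at hw
      linarith

/-! ### Concentration of the gap -/

/-- The law of the table of rewards. -/
noncomputable def rewardLaw (ν : Fin 2 → ProbabilityMeasure ℝ) : Measure (ℕ × Fin 2 → ℝ) :=
  Measure.infinitePi fun i : ℕ × Fin 2 => (ν i.2 : Measure ℝ)

instance (ν : Fin 2 → ProbabilityMeasure ℝ) : IsProbabilityMeasure (rewardLaw ν) := by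
  unfold rewardLaw
  infer_instance

theorem measurable_gap (n : ℕ) : Measurable fun y => gap y n := by
  unfold gap
  refine Measurable.const_mul (Finset.measurable_sum _ fun s _ => ?_) _
  split_ifs <;> fun_prop

theorem lintegral_interactionLaw (ν : Fin 2 → ProbabilityMeasure ℝ)
    {f : (ℕ × Fin 2 → ℝ) → ENNReal} (hf : Measurable f) :
    ∫⁻ z, f z.2 ∂(interactionLaw ν) = ∫⁻ y, f y ∂(rewardLaw ν) :=
  (measurePreserving_snd (μ := (volume : Measure unitInterval)) (ν := rewardLaw ν)).lintegral_comp
    hf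

/-- The centred reward of round `t`, signed so that large sums favour the arm `1`. -/
noncomputable def noise (ν : Fin 2 → ProbabilityMeasure ℝ) (t : ℕ) (x : ℝ) : ℝ :=
  if t % 2 = 1 then x - armMean (ν 1) else -(x - armMean (ν 0))

theorem measurable_noise (ν : Fin 2 → ProbabilityMeasure ℝ) (t : ℕ) : Measurable (noise ν t) := by
  unfold noise
  split_ifs <;> fun_prop

theorem sum_noise (ν : Fin 2 → ProbabilityMeasure ℝ) (y : ℕ × Fin 2 → ℝ) {n : ℕ} (hn : 1 ≤ n) :
    ∑ t ∈ Finset.range (2 * n), noise ν t (y (t, turn t)) =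
      n * (armMean (ν 0) - armMean (ν 1) - gap y n) := by
  have hn' : (n : ℝ) ≠ 0 := by positivity
  rw [gap, mul_sub, mul_inv_cancel_left₀ hn']
  clear hn hn'
  induction n with
  | zero => simp
  | succ n ih =>
    have h3 : ¬ 2 * n % 2 = 1 := by omega
    have h4 : (2 * n + 1) % 2 = 1 := by omega
    rw [show 2 * (n + 1) = 2 * n + 1 + 1 by ring, Finset.sum_range_succ, Finset.sum_range_succ, ih,
      Finset.sum_range_succ _ (2 * n + 1), Finset.sum_range_succ _ (2 * n)]
    simp only [noise, turn, if_neg h3, if_pos h4]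
    push_cast
    ring

theorem hasSubgaussianMGF_noise {σ B : ℝ} {ν : Fin 2 → ProbabilityMeasure ℝ}
    (hν : ν ∈ banditModels σ B) (t : ℕ) :
    HasSubgaussianMGF (fun y : ℕ × Fin 2 → ℝ => noise ν t (y (t, turn t))) (σ ^ 2).toNNReal
      (rewardLaw ν) := by
  have h : HasSubgaussianMGF (noise ν t) (σ ^ 2).toNNReal (ν (turn t) : Measure ℝ) := by
    unfold noise turn
    split_ifs with h
    · exact (hν 1).1
    · exact (hν 0).1.neg
  refine HasSubgaussianMGF.of_map (X := noise ν t) (Y := fun y : ℕ × Fin 2 → ℝ => y (t, turn t))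
    (Measurable.aemeasurable (by fun_prop)) ?_
  rwa [rewardLaw, Measure.infinitePi_map_eval (fun i : ℕ × Fin 2 => (ν i.2 : Measure ℝ))]

/-- Different rounds read different entries of the product table, since t ↦ (t, `turn` t) is
injective. -/
theorem iIndepFun_noise (ν : Fin 2 → ProbabilityMeasure ℝ) :
    iIndepFun (fun (t : ℕ) (y : ℕ × Fin 2 → ℝ) => noise ν t (y (t, turn t))) (rewardLaw ν) :=
  (iIndepFun_infinitePi (P := fun i : ℕ × Fin 2 => (ν i.2 : Measure ℝ))
    (X := fun i => noise ν i.1) fun i => measurable_noise ν i.1).precomp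
    (g := fun t : ℕ => (t, turn t)) fun _ _ h => congrArg Prod.fst h

/-- The sub-Gaussian lower tail of the difference of the empirical means. -/
theorem rewardLaw_gap_le {σ B Δ : ℝ} {ν : Fin 2 → ProbabilityMeasure ℝ}
    (hν : ν ∈ gapModels σ B Δ) {n : ℕ} (hn : 1 ≤ n) {s : ℝ} (hs : s ≤ Δ) :
    rewardLaw ν {y | gap y n ≤ s} ≤
      ENNReal.ofReal (Real.exp (-(n * (Δ - s) ^ 2 / (4 * σ ^ 2)))) := by
  have hn' : (0 : ℝ) < n := by positivity
  have h := HasSubgaussianMGF.measure_sum_range_ge_le_of_iIndepFun (n := 2 * n) (iIndepFun_noise ν)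
    (fun i _ => hasSubgaussianMGF_noise hν.1 i) (ε := n * (Δ - s))
    (mul_nonneg hn'.le (sub_nonneg.2 hs))
  -- The 2n centred rewards sum to n(Δ - `gap`), with total variance proxy 2nσ²; hence the exponent
  -- n²(Δ - s)²/(4nσ²).
  have hset : {y | n * (Δ - s) ≤ ∑ t ∈ Finset.range (2 * n), noise ν t (y (t, turn t))} =
      {y | gap y n ≤ s} := by
    ext y
    simp only [Set.mem_ofPred_eq]
    rw [sum_noise ν y hn, hν.2, mul_le_mul_iff_right₀ hn']
    constructor <;> intro <;> linarith
  rw [hset] at h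
  rw [← ENNReal.ofReal_toReal (measure_ne_top (rewardLaw ν) {y | gap y n ≤ s})]
  refine ENNReal.ofReal_le_ofReal (h.trans_eq ?_)
  congr 1
  rw [Real.coe_toNNReal _ (sq_nonneg σ)]
  push_cast
  -- For σ = 0 both exponents are quotients by 0, hence 0.
  rcases eq_or_ne σ 0 with rfl | hσ
  · simp
  · field_simp
    ring

theorem measurableSet_gap_le (n : ℕ) (s : ℝ) : MeasurableSet {y | gap y n ≤ s} :=
  measurableSet_le (measurable_gap n) measurable_const

/-! ### Reduction of the risk to events at fixed times -/

open Classical in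
theorem indicator_recommends_le {N : ℝ} (hN : 0 ≤ N) (σ δ : ℝ) (ν : Fin 2 → ProbabilityMeasure ℝ)
    (u : unitInterval) (y : ℕ × Fin 2 → ℝ) :
    (if ∃ a, (policy σ N δ).Recommends u y a ∧ armMean (ν 0) ≠ armMean (ν a) then 1 else 0 :
      ENNReal) ≤ {y | gap y (⌊N⌋₊ + 1) ≤ 0}.indicator 1 y +
        ∑ k ∈ Finset.range ⌊N⌋₊,
          {y | gap y (k + 1) ≤ -width σ δ (k + 1)}.indicator 1 y := by
  split_ifs with h
  · obtain ⟨a, ha, hne⟩ := h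
    obtain rfl : a = 1 := by
      by_contra h1
      obtain rfl : a = 0 := by omega
      exact hne rfl
    obtain ⟨T, -, -, -, hT⟩ := exists_epochs hN σ δ u y
    rcases hT ha with h0 | ⟨n, hn1, hnN, hn⟩
    · refine le_add_right ?_
      rw [Set.indicator_of_mem (by exact h0)]
      rfl
    · refine le_add_left ?_
      obtain ⟨k, rfl⟩ := Nat.exists_eq_add_of_le' hn1
      refine le_trans ?_ (Finset.single_le_sum (fun _ _ => zero_le)
        (Finset.mem_range.2 (Nat.lt_of_succ_le hnN)))
      rw [Set.indicator_of_mem (by exact hn)]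
      rfl
  · exact zero_le

/-- The first epoch is unconditional and gives the 1; each later one requires that the arms had not
separated after the epoch before, of which only the upper side `gap` ≤ `width` is kept. -/
theorem stopTime_le {N : ℝ} (hN : 0 ≤ N) (σ δ : ℝ) (u : unitInterval) (y : ℕ × Fin 2 → ℝ) :
    ((policy σ N δ).stopTime u y : ENNReal) ≤
      2 * (1 + ∑ k ∈ Finset.range ⌊N⌋₊,
          {y | gap y (k + 1) ≤ width σ δ (k + 1)}.indicator 1 y) := by
  obtain ⟨T, hTm, hT, hτ, -⟩ := exists_epochs hN σ δ u y
  rw [hτ]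
  push_cast
  gcongr
  rcases T with _ | T
  · simp
  · rw [Nat.cast_add, Nat.cast_one, add_comm]
    gcongr
    calc (T : ENNReal) = ∑ k ∈ Finset.range T,
          {y | gap y (k + 1) ≤ width σ δ (k + 1)}.indicator 1 y := by
            rw [Finset.sum_congr rfl fun k hk => Set.indicator_of_mem (show y ∈
              {y | gap y (k + 1) ≤ width σ δ (k + 1)} from
                (le_abs_self _).trans (hT (k + 1) (by have := Finset.mem_range.1 hk; omega))) 1]
            simp
      _ ≤ _ := Finset.sum_le_sum_of_subset (Finset.range_subset_range.2 (by omega))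

theorem riskOne_le_trivial {N c : ℝ} (hN : 0 ≤ N) (hc : 0 ≤ c) (σ δ : ℝ)
    (ν : Fin 2 → ProbabilityMeasure ℝ) :
    riskOne c (policy σ N δ) ν ≤ ENNReal.ofReal (1 + 2 * c * (N + 1)) := by
  have : IsProbabilityMeasure (interactionLaw ν) := by
    unfold interactionLaw
    infer_instance
  refine (lintegral_mono (g := fun _ => ENNReal.ofReal (1 + 2 * c * (N + 1)))
    fun z => ?_).trans_eq (by simp)
  rw [ENNReal.ofReal_add zero_le_one (by positivity), ENNReal.ofReal_one]
  refine add_le_add ?_ ?_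
  · split_ifs <;> simp
  · obtain ⟨T, hTm, -, hτ, -⟩ := exists_epochs hN σ δ z.1 z.2
    have h1 : (((policy σ N δ).stopTime z.1 z.2 : ℕ∞) : ENNReal) =
        ENNReal.ofReal ((2 * T : ℕ) : ℝ) := by
      rw [hτ, ENNReal.ofReal_natCast]
      simp
    rw [h1, ← ENNReal.ofReal_mul hc]
    refine ENNReal.ofReal_le_ofReal ?_
    have h2 : (T : ℝ) ≤ N + 1 := by
      have h3 : (T : ℝ) ≤ ⌊N⌋₊ + 1 := by exact_mod_cast hTm
      linarith [Nat.floor_le hN]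
    push_cast
    nlinarith

theorem riskOne_le_sum {N : ℝ} (hN : 0 ≤ N) (σ δ c : ℝ) (ν : Fin 2 → ProbabilityMeasure ℝ) :
    riskOne c (policy σ N δ) ν ≤ rewardLaw ν {y | gap y (⌊N⌋₊ + 1) ≤ 0} +
      ∑ k ∈ Finset.range ⌊N⌋₊, rewardLaw ν {y | gap y (k + 1) ≤ -width σ δ (k + 1)} +
      ENNReal.ofReal c * (2 * (1 + ∑ k ∈ Finset.range ⌊N⌋₊,
        rewardLaw ν {y | gap y (k + 1) ≤ width σ δ (k + 1)})) := by
  have hmeas : ∀ n s, Measurable ({y | gap y n ≤ s}.indicator (1 : (ℕ × Fin 2 → ℝ) → ENNReal)) :=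
    fun n s => measurable_one.indicator (measurableSet_gap_le n s)
  have hsum : ∀ s : ℕ → ℝ, Measurable fun y => ∑ k ∈ Finset.range ⌊N⌋₊,
      {y | gap y (k + 1) ≤ s k}.indicator (1 : (ℕ × Fin 2 → ℝ) → ENNReal) y :=
    fun s => Finset.measurable_sum _ fun k _ => hmeas _ _
  have hint : ∀ s : ℕ → ℝ, ∫⁻ y, ∑ k ∈ Finset.range ⌊N⌋₊,
      {y | gap y (k + 1) ≤ s k}.indicator (1 : (ℕ × Fin 2 → ℝ) → ENNReal) y ∂rewardLaw ν =
      ∑ k ∈ Finset.range ⌊N⌋₊, rewardLaw ν {y | gap y (k + 1) ≤ s k} := fun s => by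
    rw [lintegral_finsetSum _ fun k _ => hmeas _ _]
    exact Finset.sum_congr rfl fun k _ => lintegral_indicator_one (measurableSet_gap_le _ _)
  have key : ∀ f g h : (ℕ × Fin 2 → ℝ) → ENNReal, Measurable f → Measurable g → Measurable h →
      ∫⁻ z, (f z.2 + g z.2 + ENNReal.ofReal c * (2 * (1 + h z.2))) ∂interactionLaw ν =
      ∫⁻ y, f y ∂rewardLaw ν + ∫⁻ y, g y ∂rewardLaw ν +
        ENNReal.ofReal c * (2 * (1 + ∫⁻ y, h y ∂rewardLaw ν)) := by
    intro f g h hf hg hh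
    rw [lintegral_interactionLaw ν (f := fun y => f y + g y + ENNReal.ofReal c * (2 * (1 + h y)))
        (by fun_prop), lintegral_add_left (by fun_prop), lintegral_add_left hf,
      lintegral_const_mul _ (by fun_prop), lintegral_const_mul _ (by fun_prop),
      lintegral_add_left measurable_const]
    simp
  rw [← hint fun k => -width σ δ (k + 1), ← hint fun k => width σ δ (k + 1),
    ← lintegral_indicator_one (measurableSet_gap_le _ _),
    ← key _ _ _ (hmeas _ _) (hsum _) (hsum _)]
  refine lintegral_mono fun z => add_le_add (indicator_recommends_le hN σ δ ν z.1 z.2) ?_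
  gcongr
  exact stopTime_le hN σ δ z.1 z.2

/-! ### Summation of the tails -/

/-- Telescoping: a ≤ exp a - 1 bounds each term by a⁻¹ times a difference of consecutive
exponentials. -/
theorem sum_exp_neg_le {a : ℝ} (ha : 0 < a) (M : ℕ) :
    ∑ k ∈ Finset.range M, Real.exp (-((k + 1 : ℕ) * a)) ≤ a⁻¹ := by
  have h : ∑ k ∈ Finset.range M, Real.exp (-((k + 1 : ℕ) * a)) ≤
      (1 - Real.exp (-(M * a))) * a⁻¹ := by
    induction M with
    | zero => simp
    | succ M ih =>
      rw [Finset.sum_range_succ]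
      have h1 : Real.exp (-(M * a)) = Real.exp (-((M + 1 : ℕ) * a)) * Real.exp a := by
        rw [← Real.exp_add]
        congr 1
        push_cast
        ring
      have h2 : Real.exp (-((M + 1 : ℕ) * a)) ≤
          (Real.exp (-(M * a)) - Real.exp (-((M + 1 : ℕ) * a))) * a⁻¹ := by
        rw [← div_eq_mul_inv, le_div_iff₀ ha, h1]
        nlinarith [Real.add_one_le_exp a, Real.exp_pos (-((M + 1 : ℕ) * a))]
      calc _ ≤ _ := add_le_add ih h2
        _ = _ := by ring
  refine h.trans ?_
  have := inv_pos.2 ha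
  nlinarith [Real.exp_pos (-(M * a))]

theorem exp_neg_le {y : ℝ} (hy : 0 < y) : Real.exp (-y) ≤ (Real.exp 1 * y)⁻¹ := by
  rw [Real.exp_neg]
  refine inv_anti₀ (by positivity) ?_
  have h := Real.add_one_le_exp (y - 1)
  calc Real.exp 1 * y ≤ Real.exp 1 * Real.exp (y - 1) := by gcongr; linarith
    _ = Real.exp y := by rw [← Real.exp_add]; congr 1; ring

theorem sq_width {σ δ : ℝ} {n : ℕ} (hn : 1 ≤ n) (hδ : 0 < δ) (hδ1 : δ ≤ 1) :
    width σ δ n ^ 2 = 4 * σ ^ 2 * (n : ℝ)⁻¹ * Real.log (2 * n * δ⁻¹) := by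
  refine Real.sq_sqrt (mul_nonneg (by positivity) (Real.log_nonneg ?_))
  have h1 : (1 : ℝ) ≤ n := by exact_mod_cast hn
  have h2 : 1 ≤ δ⁻¹ := (one_le_inv₀ hδ).2 hδ1
  nlinarith

/-- The probability that the arms separate in the wrong order. -/
theorem sum_rewardLaw_gap_le_neg_width {σ B Δ δ : ℝ} (hσ : 0 < σ) (hΔ : 0 < Δ) (hδ : 0 < δ)
    (hδ1 : δ ≤ 1) {ν : Fin 2 → ProbabilityMeasure ℝ} (hν : ν ∈ gapModels σ B Δ) (M : ℕ) :
    ∑ k ∈ Finset.range M, rewardLaw ν {y | gap y (k + 1) ≤ -width σ δ (k + 1)} ≤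
      ENNReal.ofReal (2 * δ * σ ^ 2 / Δ ^ 2) := by
  have ha : 0 < Δ ^ 2 / (4 * σ ^ 2) := by positivity
  have hterm : ∀ k, rewardLaw ν {y | gap y (k + 1) ≤ -width σ δ (k + 1)} ≤
      ENNReal.ofReal (δ / 2 * Real.exp (-((k + 1 : ℕ) * (Δ ^ 2 / (4 * σ ^ 2))))) := by
    intro k
    have hw := width_nonneg σ δ (k + 1)
    have hk : (1 : ℝ) ≤ (k + 1 : ℕ) := by exact_mod_cast Nat.le_add_left 1 k
    refine (rewardLaw_gap_le hν (Nat.le_add_left 1 k) (by linarith)).trans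
      (ENNReal.ofReal_le_ofReal ?_)
    -- The cross term of (Δ + `width`)² is dropped. The square of `width` produces the factor δ/(2n)
    -- ≤ δ/2, and Δ² leaves a summable exponential.
    have h1 : Real.log (2 * (k + 1 : ℕ) * δ⁻¹) + (k + 1 : ℕ) * (Δ ^ 2 / (4 * σ ^ 2)) ≤
        (k + 1 : ℕ) * (Δ - -width σ δ (k + 1)) ^ 2 / (4 * σ ^ 2) := by
      have h2 := sq_width (σ := σ) (Nat.le_add_left 1 k) hδ hδ1
      have h3 : Real.log (2 * (k + 1 : ℕ) * δ⁻¹) =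
          (k + 1 : ℕ) * width σ δ (k + 1) ^ 2 / (4 * σ ^ 2) := by
        rw [h2]
        field_simp
      rw [h3, ← mul_div_assoc, ← add_div, ← mul_add]
      gcongr
      nlinarith
    calc _ ≤ Real.exp (-(Real.log (2 * (k + 1 : ℕ) * δ⁻¹) +
          (k + 1 : ℕ) * (Δ ^ 2 / (4 * σ ^ 2)))) := Real.exp_le_exp.2 (neg_le_neg h1)
      _ = (2 * (k + 1 : ℕ) * δ⁻¹)⁻¹ * Real.exp (-((k + 1 : ℕ) * (Δ ^ 2 / (4 * σ ^ 2)))) := by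
        rw [neg_add, Real.exp_add, Real.exp_neg, Real.exp_log (by positivity)]
      _ ≤ _ := by
        gcongr
        rw [mul_inv, inv_inv, div_eq_inv_mul]
        gcongr
        linarith
  calc _ ≤ ∑ k ∈ Finset.range M,
        ENNReal.ofReal (δ / 2 * Real.exp (-((k + 1 : ℕ) * (Δ ^ 2 / (4 * σ ^ 2))))) :=
        Finset.sum_le_sum fun k _ => hterm k
    _ = ENNReal.ofReal (δ / 2 *
        ∑ k ∈ Finset.range M, Real.exp (-((k + 1 : ℕ) * (Δ ^ 2 / (4 * σ ^ 2))))) := by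
        rw [Finset.mul_sum, ENNReal.ofReal_sum_of_nonneg fun _ _ => by positivity]
    _ ≤ ENNReal.ofReal (δ / 2 * (Δ ^ 2 / (4 * σ ^ 2))⁻¹) := by
        gcongr
        exact sum_exp_neg_le ha M
    _ = _ := by
        congr 1
        field_simp
        ring

/-- The expected number of epochs after which the arms have not separated. -/
theorem sum_rewardLaw_gap_le_width {σ B Δ δ N : ℝ} (hσ : 0 < σ) (hΔ : 0 < Δ) (hδ : 0 < δ)
    (hδ1 : δ ≤ 1) {ν : Fin 2 → ProbabilityMeasure ℝ} (hν : ν ∈ gapModels σ B Δ) (hN : 0 ≤ N)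
    (hL : 0 ≤ Real.log (2 * N * δ⁻¹)) :
    ∑ k ∈ Finset.range ⌊N⌋₊, rewardLaw ν {y | gap y (k + 1) ≤ width σ δ (k + 1)} ≤
      ENNReal.ofReal (16 * σ ^ 2 / Δ ^ 2 * (Real.log (2 * N * δ⁻¹) + 1)) := by
  set L := Real.log (2 * N * δ⁻¹) with hLdef
  -- From K epochs on, `width` ≤ Δ/2, so that non-separation is a deviation of at least Δ/2. Earlier
  -- epochs are counted with probability 1.
  set K := 16 * σ ^ 2 / Δ ^ 2 * L with hK
  have hK0 : 0 ≤ K := by positivity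
  have ha : 0 < Δ ^ 2 / (16 * σ ^ 2) := by positivity
  have hterm : ∀ k ∈ Finset.range ⌊N⌋₊,
      rewardLaw ν {y | gap y (k + 1) ≤ width σ δ (k + 1)} ≤
      ENNReal.ofReal ((if k < ⌊K⌋₊ then 1 else 0) +
        Real.exp (-((k + 1 : ℕ) * (Δ ^ 2 / (16 * σ ^ 2))))) := by
    intro k hk
    split_ifs with h
    · refine prob_le_one.trans ?_
      rw [← ENNReal.ofReal_one]
      refine ENNReal.ofReal_le_ofReal ?_
      linarith [Real.exp_pos (-((k + 1 : ℕ) * (Δ ^ 2 / (16 * σ ^ 2))))]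
    · have hk0 : (0 : ℝ) < (k + 1 : ℕ) := by positivity
      have hkN : ((k + 1 : ℕ) : ℝ) ≤ N :=
        (Nat.le_floor_iff hN).1 (Nat.succ_le_of_lt (Finset.mem_range.1 hk))
      have hkK : K ≤ (k + 1 : ℕ) := by
        have h1 : ((⌊K⌋₊ + 1 : ℕ) : ℝ) ≤ (k + 1 : ℕ) := by
          exact_mod_cast Nat.succ_le_succ (not_lt.1 h)
        refine (Nat.lt_floor_add_one K).le.trans ?_
        exact_mod_cast h1
      have hlog : Real.log (2 * (k + 1 : ℕ) * δ⁻¹) ≤ L :=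
        Real.log_le_log (by positivity) (by gcongr)
      have hsq : width σ δ (k + 1) ^ 2 ≤ (Δ / 2) ^ 2 := by
        rw [sq_width (Nat.le_add_left 1 k) hδ hδ1]
        calc _ ≤ 4 * σ ^ 2 * ((k + 1 : ℕ) : ℝ)⁻¹ * L := by gcongr
          _ ≤ _ := by
            rw [hK, div_mul_eq_mul_div, div_le_iff₀ (by positivity)] at hkK
            rw [mul_right_comm, ← div_eq_mul_inv, div_le_iff₀ hk0]
            linarith
      have hw : width σ δ (k + 1) ≤ Δ / 2 :=
        (sq_le_sq₀ (width_nonneg _ _ _) (by positivity)).1 hsq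
      refine (rewardLaw_gap_le hν (Nat.le_add_left 1 k) (by linarith)).trans
        (ENNReal.ofReal_le_ofReal ?_)
      rw [zero_add]
      refine Real.exp_le_exp.2 (neg_le_neg ?_)
      rw [← mul_div_assoc, div_le_div_iff₀ (by positivity) (by positivity)]
      have h2 : Δ ^ 2 ≤ 4 * (Δ - width σ δ (k + 1)) ^ 2 := by nlinarith
      nlinarith [mul_le_mul_of_nonneg_left h2
        (show (0 : ℝ) ≤ (k + 1 : ℕ) * (4 * σ ^ 2) by positivity)]
  calc _ ≤ ∑ k ∈ Finset.range ⌊N⌋₊, ENNReal.ofReal ((if k < ⌊K⌋₊ then 1 else 0) +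
        Real.exp (-((k + 1 : ℕ) * (Δ ^ 2 / (16 * σ ^ 2))))) := Finset.sum_le_sum hterm
    _ = ENNReal.ofReal (∑ k ∈ Finset.range ⌊N⌋₊, (if k < ⌊K⌋₊ then 1 else 0) +
        ∑ k ∈ Finset.range ⌊N⌋₊, Real.exp (-((k + 1 : ℕ) * (Δ ^ 2 / (16 * σ ^ 2))))) := by
        rw [← Finset.sum_add_distrib, ENNReal.ofReal_sum_of_nonneg]
        intro k _
        split_ifs <;> positivity
    _ ≤ ENNReal.ofReal (K + (Δ ^ 2 / (16 * σ ^ 2))⁻¹) := by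
        refine ENNReal.ofReal_le_ofReal (add_le_add ?_ (sum_exp_neg_le ha _))
        rw [Finset.sum_boole]
        refine le_trans ?_ (Nat.floor_le hK0)
        have h3 : (Finset.range ⌊N⌋₊).filter (fun k => k < ⌊K⌋₊) ⊆ Finset.range ⌊K⌋₊ :=
          fun k hk => Finset.mem_range.2 (Finset.mem_filter.1 hk).2
        exact_mod_cast (Finset.card_le_card h3).trans_eq (Finset.card_range _)
    _ = _ := by
        congr 1
        rw [hK, inv_div]
        ring

/-- The instance-dependent bound on the risk of the racing policy. -/
theorem riskOne_le {σ B Δ δ N c : ℝ} (hσ : 0 < σ) (hΔ : 0 < Δ) (hδ : 0 < δ)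
    (hδ1 : δ ≤ 1) {ν : Fin 2 → ProbabilityMeasure ℝ} (hν : ν ∈ gapModels σ B Δ) (hN : 0 < N)
    (hL : 0 ≤ Real.log (2 * N * δ⁻¹)) (hc : 0 ≤ c) :
    riskOne c (policy σ N δ) ν ≤
      ENNReal.ofReal (4 * σ ^ 2 / (Real.exp 1 * N * Δ ^ 2) + 2 * δ * σ ^ 2 / Δ ^ 2 +
        c * (2 * (1 + 16 * σ ^ 2 / Δ ^ 2 * (Real.log (2 * N * δ⁻¹) + 1)))) := by
  have h1 : rewardLaw ν {y | gap y (⌊N⌋₊ + 1) ≤ 0} ≤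
      ENNReal.ofReal (4 * σ ^ 2 / (Real.exp 1 * N * Δ ^ 2)) := by
    refine (rewardLaw_gap_le hν (Nat.le_add_left 1 _) hΔ.le).trans (ENNReal.ofReal_le_ofReal ?_)
    have h2 : N ≤ (⌊N⌋₊ + 1 : ℕ) := by exact_mod_cast (Nat.lt_floor_add_one N).le
    rw [sub_zero]
    calc _ ≤ Real.exp (-(N * Δ ^ 2 / (4 * σ ^ 2))) := by gcongr
      -- The exponential is traded for a multiple of 1/(NΔ²), which has the scale of h₁ when N is of
      -- order 1/c.
      _ ≤ _ := exp_neg_le (by positivity)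
      _ = _ := by field_simp
  refine (riskOne_le_sum hN.le σ δ c ν).trans ?_
  rw [ENNReal.ofReal_add (by positivity) (by positivity),
    ENNReal.ofReal_add (by positivity) (by positivity), ENNReal.ofReal_mul hc,
    ENNReal.ofReal_mul zero_le_two, ENNReal.ofReal_add zero_le_one (by positivity),
    ENNReal.ofReal_one, ENNReal.ofReal_ofNat]
  gcongr
  · exact sum_rewardLaw_gap_le_neg_width hσ hΔ hδ hδ1 hν _
  · exact sum_rewardLaw_gap_le_width hσ hΔ hδ hδ1 hν hN.le hL

end Racing

/-! ### Choice of parameters and comparison with h₁ -/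

theorem log_confidence_ge {c : ℝ} (hc : 0 < c) (hc4 : c < 1 / 4) :
    3 / 2 ≤ Real.log ((Real.exp 1 + 1) / (Real.exp 1 * c) ^ 2) := by
  have he := Real.exp_one_lt_d9
  have he2 := Real.exp_one_gt_d9
  have h1 : Real.exp (3 / 2) ^ 2 = Real.exp 1 ^ 3 := by
    rw [← Real.exp_nat_mul, ← Real.exp_nat_mul]
    norm_num
  rw [Real.le_log_iff_exp_le (by positivity), le_div_iff₀ (by positivity)]
  have h3 : Real.exp (3 / 2) ≤ 4.5 := by
    refine abs_le_of_sq_le_sq' ?_ (by norm_num) |>.2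
    rw [h1]
    calc Real.exp 1 ^ 3 ≤ 2.719 ^ 3 := by gcongr; linarith
      _ ≤ _ := by norm_num
  have h4 : (Real.exp 1 * c) ^ 2 ≤ (2.72 * (1 / 4)) ^ 2 := by gcongr; linarith
  calc _ ≤ 4.5 * (2.72 * (1 / 4)) ^ 2 := by gcongr
    _ ≤ Real.exp 1 + 1 := by norm_num; linarith

theorem log_confidence_le {c : ℝ} (hc : 0 < c) :
    Real.log ((Real.exp 1 + 1) / (Real.exp 1 * c) ^ 2) ≤ 2 * Real.log (1 / c) := by
  rw [← Real.log_rpow (by positivity)]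
  refine Real.log_le_log (by positivity) ?_
  have he := Real.exp_one_gt_d9
  rw [Real.rpow_two, div_pow, div_le_div_iff₀ (by positivity) (by positivity)]
  have : 0 < c ^ 2 := by positivity
  have h2 : Real.exp 1 + 1 ≤ Real.exp 1 ^ 2 := by nlinarith
  nlinarith

theorem hardOne_ge {σ c Δ : ℝ} (hσ : 0 < σ) (hc : 0 < c) (h : √(σ ^ 2 * c) ≤ Δ) :
    σ ^ 2 * c / (4 * Δ ^ 2) ≤ hardOne σ c Δ := by
  have hs : 0 < σ ^ 2 * c := by positivity
  have hΔ : 0 < Δ := (Real.sqrt_pos.2 hs).trans_le h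
  have hx : σ ^ 2 * c ≤ Δ ^ 2 := (Real.sqrt_le_left hΔ.le).1 h
  rw [hardOne, if_pos h]
  refine le_mul_of_one_le_right (by positivity) ?_
  rw [Real.le_log_iff_exp_le (by positivity), mul_div_assoc]
  exact le_mul_of_one_le_right (Real.exp_pos 1).le ((one_le_div hs).2 hx)

theorem two_mul_hardOne_ge {σ c Δ : ℝ} (hσ : 0 < σ) (hc : 0 < c)
    (h : Real.exp 1 * (σ ^ 2 * c) ≤ Δ ^ 2) (h' : √(σ ^ 2 * c) ≤ Δ) :
    σ ^ 2 * c / (2 * Δ ^ 2) ≤ hardOne σ c Δ := by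
  have hs : 0 < σ ^ 2 * c := by positivity
  have hΔ : 0 < Δ := (Real.sqrt_pos.2 hs).trans_le h'
  rw [hardOne, if_pos h']
  have h2 : 2 ≤ Real.log (Real.exp 1 * Δ ^ 2 / (σ ^ 2 * c)) := by
    rw [Real.le_log_iff_exp_le (by positivity), mul_div_assoc,
      show (2 : ℝ) = 1 + 1 by norm_num, Real.exp_add]
    gcongr
    rwa [le_div_iff₀ hs]
  calc _ = σ ^ 2 * c / (4 * Δ ^ 2) * 2 := by
        field_simp
        norm_num
    _ ≤ _ := by gcongr

theorem racing_riskOne_le {σ B c N δ Δ : ℝ} (hσ : 0 < σ) (hc : 0 < c) (hc4 : c < 1 / 4)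
    (hN : N = (2 * Real.exp 1 * c)⁻¹) (hδ : δ = c * (1 + 2 * c * N)⁻¹)
    {ν : Fin 2 → ProbabilityMeasure ℝ} (hν : ν ∈ gapModels σ B Δ) :
    riskOne c (Racing.policy σ N δ) ν ≤ ENNReal.ofReal
      (128 * Real.log ((Real.exp 1 + 1) / (Real.exp 1 * c) ^ 2) * hardOne σ c Δ + 3 * c) := by
  have hL := log_confidence_ge hc hc4
  have he := Real.exp_one_gt_d9
  have he' := Real.exp_one_lt_d9
  have hNpos : 0 < N := by rw [hN]; positivity
  have hcN : 2 * c * N = (Real.exp 1)⁻¹ := by rw [hN]; field_simp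
  have hδpos : 0 < δ := by rw [hδ]; positivity
  have hδc : δ ≤ c := by
    rw [hδ]
    exact mul_le_of_le_one_right hc.le (inv_le_one_of_one_le₀ (by nlinarith))
  have hlog : 2 * N * δ⁻¹ = (Real.exp 1 + 1) / (Real.exp 1 * c) ^ 2 := by
    rw [hδ, hcN, hN]
    field_simp
  -- The factor e makes the logarithm in h₁ at least 2, which doubles the available bound to 64Lq,
  -- where q = σ²c/Δ².
  by_cases hx : √(σ ^ 2 * c) ≤ Δ ∧ Real.exp 1 * (σ ^ 2 * c) ≤ Δ ^ 2
  · have hΔpos : 0 < Δ := (Real.sqrt_pos.2 (by positivity)).trans_le hx.1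
    have h := two_mul_hardOne_ge hσ hc hx.2 hx.1
    refine (Racing.riskOne_le hσ hΔpos hδpos (by linarith) hν hNpos (by rw [hlog]; linarith)
      hc.le).trans (ENNReal.ofReal_le_ofReal ?_)
    rw [hlog]
    set L := Real.log ((Real.exp 1 + 1) / (Real.exp 1 * c) ^ 2)
    have hq : 0 < σ ^ 2 * c / Δ ^ 2 := by positivity
    have h1 : 4 * σ ^ 2 / (Real.exp 1 * N * Δ ^ 2) = 8 * (σ ^ 2 * c / Δ ^ 2) := by
      rw [hN]
      field_simp
      norm_num
    have h2 : 2 * δ * σ ^ 2 / Δ ^ 2 ≤ 2 * (σ ^ 2 * c / Δ ^ 2) := by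
      rw [← mul_div_assoc]
      gcongr ?_ / _
      nlinarith [sq_nonneg σ]
    have h3 : c * (2 * (1 + 16 * σ ^ 2 / Δ ^ 2 * (L + 1))) =
        2 * c + 32 * (σ ^ 2 * c / Δ ^ 2) * (L + 1) := by ring
    have h4 : σ ^ 2 * c / (2 * Δ ^ 2) = σ ^ 2 * c / Δ ^ 2 / 2 := by ring
    rw [h1, h3]
    rw [h4] at h
    have h5 : 128 * L * (σ ^ 2 * c / Δ ^ 2 / 2) ≤ 128 * L * hardOne σ c Δ := by gcongr
    -- The risk is at most 8q + 2q + 2c + 32q(L + 1), and 42q ≤ 32Lq because L ≥ 3/2.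
    nlinarith
  -- Here h₁ is 1/4 or at least 1/(4e) > 1/11, while the risk is at most 1 + 1/e + 2c.
  · have hh : 1 / 11 ≤ hardOne σ c Δ := by
      by_cases h1 : √(σ ^ 2 * c) ≤ Δ
      · have h2 : Δ ^ 2 < Real.exp 1 * (σ ^ 2 * c) := not_le.1 fun h => hx ⟨h1, h⟩
        have hΔpos : 0 < Δ := (Real.sqrt_pos.2 (by positivity)).trans_le h1
        refine le_trans ?_ (hardOne_ge hσ hc h1)
        rw [div_le_div_iff₀ (by norm_num) (by positivity)]
        have : 0 < σ ^ 2 * c := by positivity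
        nlinarith
      · rw [hardOne, if_neg h1]
        norm_num
    refine (Racing.riskOne_le_trivial hNpos.le hc.le σ δ ν).trans (ENNReal.ofReal_le_ofReal ?_)
    have h1 : (Real.exp 1)⁻¹ ≤ 1 := inv_le_one_of_one_le₀ (by linarith)
    nlinarith

theorem corollary2 (σ B : ℝ) (hσ : 0 < σ) :
    (∀ c : ℝ, 0 < c → c < 1 / 4 →
      ∀ N δ : ℝ, N = (2 * Real.exp 1 * c)⁻¹ → δ = c * (1 + 2 * c * N)⁻¹ →
      ∀ Δ : ℝ, 0 ≤ Δ →
        worstRiskOne σ B c Δ (Racing.policy σ N δ) ≤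
          ENNReal.ofReal
            (128 * Real.log ((Real.exp 1 + 1) / (Real.exp 1 * c) ^ 2) * hardOne σ c Δ + 3 * c)) ∧
    ∃ C : ℝ, ∀ c : ℝ, 0 < c → c < 1 / 4 → ∀ Δ : ℝ, 0 ≤ Δ → Δ ≤ B →
      128 * Real.log ((Real.exp 1 + 1) / (Real.exp 1 * c) ^ 2) * hardOne σ c Δ + 3 * c ≤
        C * (Real.log (1 / c) * hardOne σ c Δ) := by
  -- In C, 256 = 128 · 2 comes from L ≤ 2 log(1/c). The rest absorbs 3c: it is at most 12(B²/σ²)h₁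
  -- for large Δ and 12h₁ when h₁ = 1/4, and 1 ≤ 2 log(1/c).
  refine ⟨fun c hc hc4 N δ hN hδ Δ _ => iSup₂_le fun ν hν =>
    racing_riskOne_le hσ hc hc4 hN hδ hν, 256 + (12 + 12 * B ^ 2 / σ ^ 2) * 2, ?_⟩
  intro c hc hc4 Δ hΔ hΔB
  have hL := log_confidence_ge hc hc4
  have hL' := log_confidence_le hc
  have hD : 0 ≤ 12 * B ^ 2 / σ ^ 2 := by positivity
  have hh : 3 * c ≤ (12 + 12 * B ^ 2 / σ ^ 2) * hardOne σ c Δ ∧ 0 ≤ hardOne σ c Δ := by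
    by_cases h1 : √(σ ^ 2 * c) ≤ Δ
    · have hΔpos : 0 < Δ := (Real.sqrt_pos.2 (by positivity)).trans_le h1
      have hB : 0 < B := hΔpos.trans_le hΔB
      have h2 := hardOne_ge hσ hc h1
      have h3 : σ ^ 2 * c / (4 * B ^ 2) ≤ σ ^ 2 * c / (4 * Δ ^ 2) := by gcongr
      have h0 : 0 ≤ hardOne σ c Δ := le_trans (by positivity) h2
      refine ⟨?_, h0⟩
      calc 3 * c = 12 * B ^ 2 / σ ^ 2 * (σ ^ 2 * c / (4 * B ^ 2)) := by
            field_simp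
            norm_num
        _ ≤ 12 * B ^ 2 / σ ^ 2 * hardOne σ c Δ := by gcongr; exact h3.trans h2
        _ ≤ _ := by gcongr; linarith
    · rw [hardOne, if_neg h1]
      constructor <;> linarith
  have h1 := mul_le_mul_of_nonneg_right hL' hh.2
  have h2 : 1 ≤ 2 * Real.log (1 / c) := by linarith
  have h3 : (12 + 12 * B ^ 2 / σ ^ 2) * hardOne σ c Δ * 1 ≤
      (12 + 12 * B ^ 2 / σ ^ 2) * hardOne σ c Δ * (2 * Real.log (1 / c)) :=
    mul_le_mul_of_nonneg_left h2 (mul_nonneg (by linarith) hh.2)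
  linarith
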